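/- Let $d\ge 1$ and $N\ge 1$, and let $\mathcal B_N$ be the free Boolean algebra generated by $x_1,\dots,x_N$. Let $\mathcal L_N\subset\mathcal B_N$ be the sublattice generated by $x_1,\dots,x_N$ with the operations $\cup,\cap$, and let $\mathcal C_N\supset\mathcal L_N$ be the set of elements that can be built from $x_1,\dots,x_N$ using only $\cup$, $\cap$ and $\setminus$. A function $\mu\colon\mathcal C_N\to\mathbb R$ is called additive if $\mu(g\cup h)=\mu(g)+\mu(h)$ whenever $g\cap h=\emptyset$. For $f\in\mathcal C_N$ let $m_{f,I}$ ($\emptyset\ne I\subseteq\{1,\dots,N\}$) be the unique integers such that $$\mu(f)=\sum_{\emptyset\ne I\subseteq\{1,\dots,N\}} m_{f,I}\,\mu\Big(\bigcup_{i\in I}x_i\Big)\quad\text{for every additive }\mu .$$ For $\mathbf p=(\mathbf p_1,\dots,\mathbf p_N)\in(\mathbb R^d)^N$ the Boolean intrinsic volumes are $$V_{f,k}(\mathbf p)=\sum_{\emptyset\ne I\subseteq\{1,\dots,N\}} m_{f,I}\,V_k\big(\mathrm{conv}\{\mathbf p_i: i\in I\}\big),$$ where $V_k$ is the $k$-th intrinsic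 volume of a nonempty compact convex set $K\subset\mathbb R^d$, defined by Steiner's formula $\mathrm{vol}_d(K+B^d(\mathbf 0,r))=\sum_{k=0}^d\kappa_{d-k}V_k(K)r^{d-k}$ for $r\ge 0$, and $\kappa_n$ is the volume of the unit ball of $\mathbb R^n$. An element $f\in\mathcal L_N$ is evaluated on real numbers by writing it as an expression in $x_1,\dots,x_N$, $\cup$, $\cap$ and setting $a\cup b=\max\{a,b\}$, $a\cap b=\min\{a,b\}$; the value does not depend on the expression. Theorem. If $f\in\mathcal L_N$, then for any $\mathbf p\in(\mathbb R^d)^N$ the integrand below is integrable and $$V_{f,1}(\mathbf p)=\frac{1}{\kappa_{d-1}}\int_{\mathbb S^{d-1}}f(\langle\mathbf u,\mathbf p_1\rangle,\dots,\langle\mathbf u,\mathbf p_N\rangle)\,\mathrm d\mathbf u,$$ where $\mathrm d\mathbf u$ is the surface measure of the unit sphere $\mathbb S^{d-1}\subset\mathbb R^d$. -/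

import Mathlib

noncomputable section

namespace BooleanVolume

open MeasureTheory
open scoped Pointwise

/-! ### The free Boolean algebra and its sublattices -/

/-- The free Boolean algebra on `N` generators, in its standard model as the algebra of all sets
of atoms. The atoms are indexed by the subsets `I` of the index set, the index `I` standing for
`a_I = (⋂_{j ∉ I} x_j) \ (⋃_{i ∈ I} x_i)`; thus `I ∈ f` means `a_I ⊆ f`. -/
abbrev BoolAlg (N : ℕ) : Type := Set (Finset (Fin N))

/-- The free generator `x_j`: it contains exactly the atoms `a_I` with `j ∉ I`. -/
def gen {N : ℕ} (j : Fin N) : BoolAlg N := {I | j ∉ I}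

/-- The sublattice of the free Boolean algebra generated by `x_1, …, x_N` and the operations
`∪` and `∩`. -/
def LatN (N : ℕ) : Set (BoolAlg N) := latticeClosure (Set.range (gen (N := N)))

/-- The elements that can be built from the generators with `∪`, `∩` and `\` only. -/
inductive IsSetExpr {N : ℕ} : BoolAlg N → Prop
  | gen (j : Fin N) : IsSetExpr (gen j)
  | union {f g : BoolAlg N} : IsSetExpr f → IsSetExpr g → IsSetExpr (f ∪ g)
  | inter {f g : BoolAlg N} : IsSetExpr f → IsSetExpr g → IsSetExpr (f ∩ g)
  | diff {f g : BoolAlg N} : IsSetExpr f → IsSetExpr g → IsSetExpr (f \ g)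

/-- The lattice of the elements built from the generators with `∪`, `∩` and `\`. -/
def CN (N : ℕ) : Set (BoolAlg N) := {f | IsSetExpr f}

theorem LatN_subset_CN {N : ℕ} : LatN N ⊆ CN N := by
  refine latticeClosure_min ?_ ⟨fun f hf g hg => IsSetExpr.union hf hg,
    fun f hf g hg => IsSetExpr.inter hf hg⟩
  rintro _ ⟨j, rfl⟩
  exact IsSetExpr.gen j

/-! ### Evaluation on real numbers -/

/-- Formal expressions in `N` variables and the operations `∪` and `∩`. -/
inductive LatExpr (N : ℕ) : Type
  | var (j : Fin N) : LatExpr N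
  | union (s t : LatExpr N) : LatExpr N
  | inter (s t : LatExpr N) : LatExpr N

/-- The element of the free Boolean algebra represented by a formal expression. -/
def LatExpr.toBool {N : ℕ} : LatExpr N → BoolAlg N
  | .var j => gen j
  | .union s t => s.toBool ∪ t.toBool
  | .inter s t => s.toBool ∩ t.toBool

/-- The value of a formal expression on real numbers: `∪` is the maximum, `∩` the minimum. -/
def LatExpr.eval {N : ℕ} (y : Fin N → ℝ) : LatExpr N → ℝ
  | .var j => y j
  | .union s t => max (s.eval y) (t.eval y)
  | .inter s t => min (s.eval y) (t.eval y)

theorem exists_expr {N : ℕ} (f : LatN N) : ∃ e : LatExpr N, e.toBool = (f : BoolAlg N) := by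
  have h : LatN N ⊆ Set.range (LatExpr.toBool (N := N)) := by
    refine latticeClosure_min ?_ ⟨?_, ?_⟩
    · rintro _ ⟨j, rfl⟩
      exact ⟨.var j, rfl⟩
    · rintro _ ⟨s, rfl⟩ _ ⟨t, rfl⟩
      exact ⟨.union s t, rfl⟩
    · rintro _ ⟨s, rfl⟩ _ ⟨t, rfl⟩
      exact ⟨.inter s t, rfl⟩
  exact h f.2

/-- The value `f(y_1, …, y_N)` of an element `f` of the lattice on real numbers, computed from
any formal expression for `f`; see `evalReal_eq` for the independence of the expression. -/
def evalReal {N : ℕ} (f : LatN N) (y : Fin N → ℝ) : ℝ := (exists_expr f).choose.eval y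

theorem LatExpr.le_eval_iff {N : ℕ} (y : Fin N → ℝ) (c : ℝ) (e : LatExpr N) :
    c ≤ e.eval y ↔ Finset.univ.filter (fun i => y i < c) ∈ e.toBool := by
  induction e with
  | var j => simp [LatExpr.eval, LatExpr.toBool, gen]
  | union s t hs ht => simp [LatExpr.eval, LatExpr.toBool, hs, ht]
  | inter s t hs ht => simp [LatExpr.eval, LatExpr.toBool, hs, ht]

theorem evalReal_eq {N : ℕ} (f : LatN N) (y : Fin N → ℝ) (e : LatExpr N)
    (he : e.toBool = (f : BoolAlg N)) : evalReal f y = e.eval y := by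
  refine eq_of_forall_le_iff fun c => ?_
  rw [evalReal, LatExpr.le_eval_iff, LatExpr.le_eval_iff, (exists_expr f).choose_spec, he]

/-! ### Additive functions and the coefficients of the decomposition -/

/-- Real valued functions on `CN N` that are additive on disjoint elements. -/
def IsAdditive {N : ℕ} (μ : CN N → ℝ) : Prop :=
  ∀ f g : CN N, (f : BoolAlg N) ∩ g = ∅ → μ ⟨f ∪ g, IsSetExpr.union f.2 g.2⟩ = μ f + μ g

/-- The nonempty subsets of the index set. -/
abbrev NonemptySubset (N : ℕ) : Type := {I : Finset (Fin N) // I.Nonempty}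

theorem iUnion_gen_mem {N : ℕ} (I : Finset (Fin N)) (hI : I.Nonempty) :
    (⋃ i ∈ I, gen i) ∈ CN N := by
  induction hI using Finset.Nonempty.cons_induction with
  | singleton a => simpa [CN] using IsSetExpr.gen a
  | cons a s ha hs ih =>
    have : (⋃ i ∈ Finset.cons a s ha, gen i) = gen a ∪ ⋃ i ∈ s, gen (N := N) i := by
      ext; simp
    rw [this]
    exact IsSetExpr.union (IsSetExpr.gen a) ih

/-- The union `u_I = ⋃_{i ∈ I} x_i` of a nonempty family of generators. -/
def unionGen {N : ℕ} (I : NonemptySubset N) : CN N :=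
  ⟨⋃ i ∈ I.1, gen i, iUnion_gen_mem I.1 I.2⟩

/-- The property that defines the integers `m_{f,I}`. -/
def IsDecomposition {N : ℕ} (f : CN N) (m : NonemptySubset N → ℤ) : Prop :=
  ∀ μ : CN N → ℝ, IsAdditive μ → μ f = ∑ I, (m I : ℝ) * μ (unionGen I)

theorem IsSetExpr.univ_notMem {N : ℕ} {f : BoolAlg N} (hf : IsSetExpr f) :
    Finset.univ ∉ f := by
  induction hf with
  | gen j => simp [BooleanVolume.gen]
  | union _ _ h1 h2 => simp [h1, h2]
  | inter _ _ h1 h2 => simp [h1]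
  | diff _ _ h1 h2 => simp [h1]

theorem IsSetExpr.nonempty_index {N : ℕ} {f : BoolAlg N} (hf : IsSetExpr f) :
    Nonempty (Fin N) := by
  induction hf with
  | gen j => exact ⟨j⟩
  | union _ _ h1 h2 => exact h1
  | inter _ _ h1 h2 => exact h1
  | diff _ _ h1 h2 => exact h1

theorem isSetExpr_singleton {N : ℕ} {I : Finset (Fin N)} (hI : I ≠ Finset.univ) :
    IsSetExpr ({I} : BoolAlg N) := by
  obtain ⟨j, hj⟩ : ∃ j, j ∉ I := by
    by_contra! h
    exact hI (Finset.eq_univ_iff_forall.2 h)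
  have key : ∀ s : Finset (Fin N),
      IsSetExpr ({J | j ∉ J ∧ ∀ k ∈ s, (k ∈ J ↔ k ∈ I)} : BoolAlg N) := by
    intro s
    induction s using Finset.induction_on with
    | empty =>
      convert IsSetExpr.gen j using 1
      ext J
      simp [BooleanVolume.gen]
    | insert k s hk ih =>
      by_cases hkI : k ∈ I
      · convert IsSetExpr.diff ih (IsSetExpr.gen k) using 1
        ext J
        simp only [Finset.mem_insert, forall_eq_or_imp, Set.mem_ofPred_eq, Set.mem_sdiff,
          BooleanVolume.gen]
        tauto
      · convert IsSetExpr.inter ih (IsSetExpr.gen k) using 1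
        ext J
        simp only [Finset.mem_insert, forall_eq_or_imp, Set.mem_ofPred_eq, Set.mem_inter_iff,
          BooleanVolume.gen]
        tauto
  convert key Finset.univ using 1
  ext J
  simp only [Set.mem_singleton_iff, Finset.mem_univ, forall_const, Set.mem_ofPred_eq]
  constructor
  · rintro rfl
    exact ⟨hj, fun _ => Iff.rfl⟩
  · rintro ⟨-, h⟩
    exact Finset.ext h

theorem mem_CN_of_univ_notMem {N : ℕ} [Nonempty (Fin N)] {f : BoolAlg N}
    (hf : Finset.univ ∉ f) : f ∈ CN N := by
  induction f, f.toFinite using Set.Finite.induction_on with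
  | empty =>
    obtain ⟨j⟩ := ‹Nonempty (Fin N)›
    simpa [CN] using IsSetExpr.diff (IsSetExpr.gen j) (IsSetExpr.gen j)
  | @insert I f _ _ ih =>
    rw [Set.mem_insert_iff, not_or] at hf
    rw [Set.insert_eq]
    exact IsSetExpr.union (isSetExpr_singleton (Ne.symm hf.1)) (ih hf.2)

open Classical in
/-- The value of `μ` at an atom (and `0` at the atom outside of `CN N`). -/
def atomVal {N : ℕ} (μ : CN N → ℝ) (I : Finset (Fin N)) : ℝ :=
  if h : I ≠ Finset.univ then μ ⟨{I}, isSetExpr_singleton h⟩ else 0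

open Classical in
theorem IsAdditive.eq_sum {N : ℕ} {μ : CN N → ℝ} (hμ : IsAdditive μ) (f : CN N) :
    μ f = ∑ I with I ∈ (f : BoolAlg N), atomVal μ I := by
  obtain ⟨f, hf⟩ := f
  have : Nonempty (Fin N) := IsSetExpr.nonempty_index hf
  induction f, f.toFinite using Set.Finite.induction_on with
  | empty =>
    have h := hμ ⟨∅, hf⟩ ⟨∅, hf⟩ (by simp)
    simp only [Set.union_self] at h
    simpa using h
  | @insert I f hIf _ ih =>
    have hu := IsSetExpr.univ_notMem hf
    rw [Set.mem_insert_iff, not_or] at hu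
    have hf' := mem_CN_of_univ_notMem hu.2
    have h := hμ ⟨{I}, isSetExpr_singleton (Ne.symm hu.1)⟩ ⟨f, hf'⟩ (by simpa using hIf)
    have h1 : Finset.univ.filter (fun J => J ∈ insert I f)
        = insert I (Finset.univ.filter (fun J => J ∈ f)) := by
      ext J; simp
    simp only [h1]
    rw [Finset.sum_insert (by simpa using hIf), ← ih hf', atomVal, dif_pos (Ne.symm hu.1), ← h]
    congr 1

open Classical in
theorem existsUnique_decomposition {N : ℕ} (f : CN N) :
    ∃! m : NonemptySubset N → ℤ, IsDecomposition f m := by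
  have : Nonempty (Fin N) := IsSetExpr.nonempty_index f.2
  -- existence for single atoms, by descending induction
  have atoms : ∀ n : ℕ, ∀ I : Finset (Fin N), Iᶜ.card = n →
      ∃ m : NonemptySubset N → ℤ, ∀ μ : CN N → ℝ, IsAdditive μ →
        atomVal μ I = ∑ K, (m K : ℝ) * μ (unionGen K) := by
    intro n
    induction n using Nat.strong_induction_on with
    | _ n ih =>
      intro I hIn
      have ih' : ∀ J : Finset (Fin N), I ⊂ J → ∃ m : NonemptySubset N → ℤ,
          ∀ μ : CN N → ℝ, IsAdditive μ →
            atomVal μ J = ∑ K, (m K : ℝ) * μ (unionGen K) := fun J hJ =>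
        ih _ (hIn ▸ Finset.card_lt_card (Finset.compl_ssubset_compl.2 hJ)) J rfl
      choose! M hM using ih'
      let t : NonemptySubset N := ⟨Finset.univ, Finset.univ_nonempty⟩
      have hunion : ∀ (K : NonemptySubset N) (μ : CN N → ℝ), IsAdditive μ →
          μ (unionGen K) = ∑ J with ¬ K.1 ⊆ J, atomVal μ J := by
        intro K μ hμ
        rw [hμ.eq_sum]
        refine Finset.sum_congr ?_ fun _ _ => rfl
        ext J
        simp [unionGen, gen, Finset.not_subset]
      have htop : ∀ μ : CN N → ℝ, IsAdditive μ → μ (unionGen t) = ∑ J, atomVal μ J := by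
        intro μ hμ
        rw [hunion t μ hμ]
        refine Finset.sum_subset (Finset.subset_univ _) fun J _ hJ => ?_
        have : J = Finset.univ := by simpa [t, Finset.univ_subset_iff] using hJ
        simp [atomVal, this]
      -- the sum of the atoms above `I`
      have habove : ∀ μ : CN N → ℝ, IsAdditive μ →
          atomVal μ I = (∑ J with I ⊆ J, atomVal μ J) - ∑ J with I ⊂ J, atomVal μ J := by
        intro μ _
        have : Finset.univ.filter (fun J => I ⊆ J)
            = insert I (Finset.univ.filter (fun J => I ⊂ J)) := by
          ext J
          simp only [Finset.mem_filter, Finset.mem_univ, true_and, Finset.mem_insert]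
          rw [le_iff_lt_or_eq, or_comm, eq_comm]
        rw [this, Finset.sum_insert (by simp)]
        ring
      have hsub : ∀ μ : CN N → ℝ, IsAdditive μ →
          ∑ J with I ⊂ J, atomVal μ J
            = ∑ K, ((∑ J with I ⊂ J, M J K : ℤ) : ℝ) * μ (unionGen K) := by
        intro μ hμ
        push_cast
        simp_rw [Finset.sum_mul]
        rw [Finset.sum_comm]
        refine Finset.sum_congr rfl fun J hJ => ?_
        exact hM J (by simpa using hJ) μ hμ
      refine ⟨fun K => (if K = t then 1 else 0) - (if K.1 = I then 1 else 0)
        - ∑ J with I ⊂ J, M J K, fun μ hμ => ?_⟩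
      have hsum : ∑ J with I ⊆ J, atomVal μ J = μ (unionGen t)
          - ∑ K : NonemptySubset N, (if K.1 = I then (1 : ℝ) else 0) * μ (unionGen K) := by
        rw [htop μ hμ, ← Finset.sum_filter_add_sum_filter_not Finset.univ (fun J => I ⊆ J)]
        by_cases hI : I.Nonempty
        · have : ∑ K : NonemptySubset N, (if K.1 = I then (1 : ℝ) else 0) * μ (unionGen K)
              = μ (unionGen ⟨I, hI⟩) := by
            rw [Finset.sum_eq_single ⟨I, hI⟩]
            · simp
            · intro K _ hK
              rw [if_neg (fun h => hK (Subtype.ext h)), zero_mul]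
            · simp
          rw [this, hunion _ μ hμ]
          ring
        · have hI' : I = ∅ := Finset.not_nonempty_iff_eq_empty.1 hI
          have : ∑ K : NonemptySubset N, (if K.1 = I then (1 : ℝ) else 0) * μ (unionGen K)
              = 0 := by
            refine Finset.sum_eq_zero fun K _ => ?_
            rw [if_neg (fun h : K.1 = I => hI (h ▸ K.2)), zero_mul]
          rw [this]
          simp [hI']
      rw [habove μ hμ, hsum, hsub μ hμ]
      push_cast
      simp_rw [sub_mul]
      rw [Finset.sum_sub_distrib, Finset.sum_sub_distrib]
      simp
  choose M hM using fun I : Finset (Fin N) => atoms _ I rfl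
  refine ⟨fun K => ∑ I with I ∈ (f : BoolAlg N), M I K, fun μ hμ => ?_, fun m hm => ?_⟩
  · rw [hμ.eq_sum f]
    push_cast
    simp_rw [Finset.sum_mul]
    rw [Finset.sum_comm]
    exact Finset.sum_congr rfl fun I _ => hM I μ hμ
  · -- uniqueness, by testing on the point masses at the atoms
    have huniq : ∀ m m' : NonemptySubset N → ℤ, IsDecomposition f m → IsDecomposition f m' →
        m = m' := by
      intro m m' h h'
      have hadd : ∀ J : Finset (Fin N), IsAdditive (N := N)
          (fun g => if J ∈ (g : BoolAlg N) then (1 : ℝ) else 0) := by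
        intro J a b hab
        have : ¬ (J ∈ (a : BoolAlg N) ∧ J ∈ (b : BoolAlg N)) := fun hJ => by
          have : J ∈ (a : BoolAlg N) ∩ b := hJ
          simp [hab] at this
        by_cases ha : J ∈ (a : BoolAlg N) <;> by_cases hb : J ∈ (b : BoolAlg N) <;>
          simp_all
      have hz : ∀ J : Finset (Fin N), ∑ K : NonemptySubset N,
          ((m K : ℝ) - m' K) * (if K.1 ⊆ J then 0 else 1) = 0 := by
        intro J
        have e := (h _ (hadd J)).symm.trans (h' _ (hadd J))
        simp only [sub_mul, Finset.sum_sub_distrib, sub_eq_zero]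
        have hite : ∀ K : NonemptySubset N, (if K.1 ⊆ J then (0 : ℝ) else 1)
            = if J ∈ (unionGen K : BoolAlg N) then 1 else 0 := by
          intro K
          have : J ∈ (unionGen K : BoolAlg N) ↔ ¬ K.1 ⊆ J := by
            simp [unionGen, gen, Finset.not_subset]
          simp [this, ite_not]
        simp_rw [hite]
        exact e
      have htot : ∑ K : NonemptySubset N, ((m K : ℝ) - m' K) = 0 := by
        rw [← hz ∅]
        refine Finset.sum_congr rfl fun K _ => ?_
        rw [if_neg, mul_one]
        rw [Finset.subset_empty]
        exact K.2.ne_empty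
      have hle : ∀ J : Finset (Fin N), ∑ K : NonemptySubset N with K.1 ⊆ J,
          ((m K : ℝ) - m' K) = 0 := by
        intro J
        have := hz J
        rw [← sub_eq_zero.2 (htot.trans this.symm), ← Finset.sum_sub_distrib,
          Finset.sum_filter]
        refine Finset.sum_congr rfl fun K _ => ?_
        split_ifs <;> simp
      have hcoef : ∀ n : ℕ, ∀ K : NonemptySubset N, K.1.card = n → (m K : ℝ) - m' K = 0 := by
        intro n
        induction n using Nat.strong_induction_on with
        | _ n ih =>
          intro K hK
          rw [← hle K.1, Finset.sum_eq_single K]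
          · intro L hL hLK
            have hL' : L.1 ⊆ K.1 := by simpa using hL
            refine ih _ ?_ L rfl
            rw [← hK]
            exact Finset.card_lt_card (lt_of_le_of_ne hL' fun e => hLK (Subtype.ext e))
          · simp
      funext K
      exact_mod_cast sub_eq_zero.1 (hcoef _ K rfl)
    refine huniq _ _ hm fun μ hμ => ?_
    rw [hμ.eq_sum f]
    push_cast
    simp_rw [Finset.sum_mul]
    rw [Finset.sum_comm]
    exact Finset.sum_congr rfl fun I _ => hM I μ hμ

/-- The integers `m_{f,I}`, for `I` nonempty: the unique ones with
`μ(f) = ∑_I m_{f,I} μ(u_I)` for all additive `μ`. -/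
def decompCoeff {N : ℕ} (f : CN N) : NonemptySubset N → ℤ :=
  (existsUnique_decomposition f).choose

/-! ### Intrinsic volumes -/

/-- The volume `κ_n` of the unit ball of `ℝⁿ`. -/
def kappa (n : ℕ) : ℝ := volume.real (Metric.closedBall (0 : EuclideanSpace ℝ (Fin n)) 1)

/-- `V 0, …, V d` are the normalized coefficients in Steiner's formula for the volume of the
parallel bodies of `K ⊆ ℝᵈ`, and `V k = 0` for `k > d`. -/
def IsSteinerCoeff {d : ℕ} (K : Set (EuclideanSpace ℝ (Fin d))) (V : ℕ → ℝ) : Prop :=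
  (∀ r : ℝ, 0 ≤ r → volume.real (K + Metric.closedBall 0 r) =
    ∑ k ∈ Finset.range (d + 1), kappa (d - k) * V k * r ^ (d - k)) ∧ ∀ k, d < k → V k = 0

open Classical in
/-- The intrinsic volume `V_k(K)`, by Steiner's formula
`vol_d(K + B(0, r)) = ∑_{k=0}^d κ_{d-k} V_k(K) r^{d-k}`. It is meant for nonempty compact convex
sets, for which the `V_k(K)` exist; they are unique since a polynomial on `r ≥ 0` determines its
coefficients. (The value is `0` for sets without a Steiner formula.) -/
def intrinsicVolume {d : ℕ} (k : ℕ) (K : Set (EuclideanSpace ℝ (Fin d))) : ℝ :=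
  if h : ∃ V : ℕ → ℝ, IsSteinerCoeff K V then h.choose k else 0

/-- The convex hull `K_I(p)` of the points `p_i`, `i ∈ I`. -/
def hullOf {d N : ℕ} (p : Fin N → EuclideanSpace ℝ (Fin d)) (I : Finset (Fin N)) :
    Set (EuclideanSpace ℝ (Fin d)) := convexHull ℝ (p '' (I : Set (Fin N)))

/-- The Boolean intrinsic volume `V_{f,k}(p) = ∑_{∅ ≠ I} m_{f,I} V_k(K_I(p))`. -/
def boolIntrinsicVolume {d N : ℕ} (f : CN N) (k : ℕ) (p : Fin N → EuclideanSpace ℝ (Fin d)) : ℝ :=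
  ∑ I : NonemptySubset N, (decompCoeff f I : ℝ) * intrinsicVolume k (hullOf p I.1)

end BooleanVolume

end

/-! The formula reduces to one convex body at a time. The point mass at an atom is additive, and the
atom indexed by {i : y_i < c} lies in f exactly when c ≤ f(y), and in u_I exactly when c ≤ max_{i ∈
I} y_i. Hence the indicator of c ≤ f(y) is the combination, with coefficients m_{f,I}, of the
indicators of c ≤ max_I y, and integrating over c gives f(y) = ∑ m_{f,I} max_I y
(`evalReal_eq_sum`). For y_i = ⟨u, p_i⟩ the maximum is the support function of K_I, so it remains to
show κ_{d-1} V_1(K) = ∫ h_K for compact convex K (`kappa_mul_intrinsicVolume_one`).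

Since V_k is defined through Steiner's formula, that formula has to be established
(`exists_steiner_polynomial`). Multiplying the distance to K by s carries K + B(0,1) bijectively
onto K + B(0,s); where the nearest point map has derivative A, the Jacobian is det(A + s(1 - A)), a
positive polynomial in s.

By homogeneity vol(εK + B) is then a polynomial in ε with linear coefficient κ_{d-1} V_1(K). The
same coefficient is computed by trapping εK + B, up to the origin, between star bodies with radial
functions 1 + ε h_K + O(ε²), whose volumes are known in polar coordinates
(`exists_abs_measure_add_smul_sub_le`). -/

noncomputable section

namespace BooleanVolume

open MeasureTheory Set Filter Topology
open scoped Pointwise NNReal ENNReal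

/-! ### The nearest point map of a convex set -/

section NearestPoint

variable {E : Type*} [NormedAddCommGroup E] [InnerProductSpace ℝ E] {K : Set E} {π : E → E}

/-- The variational characterization of the metric projection onto a convex set. -/
structure IsNearestPointMap (K : Set E) (π : E → E) : Prop where
  mem : ∀ x, π x ∈ K
  inner_le : ∀ x, ∀ w ∈ K, inner ℝ (x - π x) (w - π x) ≤ 0

theorem exists_isNearestPointMap (hK : IsCompact K) (hc : Convex ℝ K) (hne : K.Nonempty) :
    ∃ π : E → E, IsNearestPointMap K π := by
  choose π hπ h using exists_norm_eq_iInf_of_complete_convex hne hK.isComplete hc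
  exact ⟨π, hπ, fun x => (norm_eq_iInf_iff_real_inner_le_zero hc (hπ x)).1 (h x)⟩

namespace IsNearestPointMap

/-- Testing the inequality at `π x` against `z`, and the one at `z` against `π x`, and adding gives
‖π x - z‖² ≤ 0. -/
theorem eq_of_inner_le (hπ : IsNearestPointMap K π) {x z : E} (hz : z ∈ K)
    (h : ∀ w ∈ K, inner ℝ (x - z) (w - z) ≤ 0) : π x = z := by
  have h1 := h _ (hπ.mem x)
  have h2 := hπ.inner_le x z hz
  have h3 : inner ℝ (π x - z) (π x - z) ≤ 0 := by
    have e1 : inner ℝ (x - π x) (z - π x) = - inner ℝ (x - π x) (π x - z) := by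
      rw [← inner_neg_right, neg_sub]
    have e2 : π x - z = (x - z) - (x - π x) := by abel
    nth_rewrite 1 [e2]
    rw [inner_sub_left]
    linarith
  rw [real_inner_self_eq_norm_sq] at h3
  exact sub_eq_zero.1 (norm_eq_zero.1 (pow_eq_zero_iff two_ne_zero |>.1 (h3.antisymm (sq_nonneg _))))

/-- Sum of the variational inequalities of `x` tested at `π y` and of `y` tested at `π x`. It is
stronger than the Lipschitz bound, and its infinitesimal form controls the Jacobian. -/
theorem firmly_nonexpansive (hπ : IsNearestPointMap K π) (x y : E) :
    ‖π x - π y‖ ^ 2 ≤ inner ℝ (π x - π y) (x - y) := by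
  have h1 := hπ.inner_le x _ (hπ.mem y)
  have h2 := hπ.inner_le y _ (hπ.mem x)
  have e1 : inner ℝ (x - π x) (π y - π x) = - inner ℝ (π x - π y) (x - π x) := by
    rw [← inner_neg_left, neg_sub, real_inner_comm]
  have e2 : inner ℝ (y - π y) (π x - π y) = inner ℝ (π x - π y) (y - π y) :=
    real_inner_comm _ _
  have e3 : x - y = (x - π x) - (y - π y) + (π x - π y) := by abel
  rw [e3, inner_add_right, inner_sub_right, real_inner_self_eq_norm_sq]
  linarith

theorem lipschitz (hπ : IsNearestPointMap K π) : LipschitzWith 1 π := by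
  refine LipschitzWith.of_dist_le_mul fun x y => ?_
  rw [NNReal.coe_one, one_mul, dist_eq_norm, dist_eq_norm]
  have h := (hπ.firmly_nonexpansive x y).trans (real_inner_le_norm _ _)
  by_contra! hlt
  nlinarith [norm_nonneg (x - y), norm_nonneg (π x - π y)]

theorem norm_sub_le (hπ : IsNearestPointMap K π) (x : E) {k : E} (hk : k ∈ K) :
    ‖x - π x‖ ≤ ‖x - k‖ := by
  have h := hπ.inner_le x k hk
  have e : x - k = (x - π x) - (k - π x) := by abel
  have h2 : ‖x - k‖ ^ 2 = ‖x - π x‖ ^ 2 - 2 * inner ℝ (x - π x) (k - π x) + ‖k - π x‖ ^ 2 := by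
    rw [e, norm_sub_sq_real]
  refine le_of_sq_le_sq ?_ (norm_nonneg _)
  nlinarith [sq_nonneg ‖k - π x‖]

/-- The parallel body is described by the distance to the nearest point. -/
theorem add_closedBall_eq (hπ : IsNearestPointMap K π) (s : ℝ) :
    K + Metric.closedBall 0 s = {x | ‖x - π x‖ ≤ s} := by
  ext x
  constructor
  · rintro ⟨k, hk, b, hb, rfl⟩
    refine (hπ.norm_sub_le _ hk).trans ?_
    simpa using hb
  · intro hx
    exact ⟨π x, hπ.mem x, x - π x, by simpa using hx, by simp⟩

/-- The map that multiplies the distance to the convex set by `s`. -/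
def scaling (π : E → E) (s : ℝ) (x : E) : E := π x + s • (x - π x)

/-- The variational inequality is homogeneous in `x - π x`, so all points of the ray from `π x`
through `x` share their nearest point. -/
theorem apply_scaling (hπ : IsNearestPointMap K π) {s : ℝ} (hs : 0 ≤ s) (x : E) :
    π (scaling π s x) = π x := by
  refine hπ.eq_of_inner_le (hπ.mem x) fun w hw => ?_
  rw [scaling, add_sub_cancel_left, real_inner_smul_left]
  exact mul_nonpos_of_nonneg_of_nonpos hs (hπ.inner_le x w hw)

theorem scaling_scaling (hπ : IsNearestPointMap K π) {s t : ℝ} (hs : 0 ≤ s) (x : E) :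
    scaling π t (scaling π s x) = scaling π (t * s) x := by
  rw [scaling, hπ.apply_scaling hs, scaling, add_sub_cancel_left, smul_smul, scaling]

theorem scaling_injective (hπ : IsNearestPointMap K π) {s : ℝ} (hs : 0 < s) :
    Function.Injective (scaling π s) := by
  refine Function.LeftInverse.injective (g := scaling π s⁻¹) fun x => ?_
  rw [hπ.scaling_scaling hs.le, inv_mul_cancel₀ hs.ne', scaling, one_smul, add_sub_cancel]

theorem image_scaling (hπ : IsNearestPointMap K π) {s : ℝ} (hs : 0 < s) :
    scaling π s '' (K + Metric.closedBall 0 1) = K + Metric.closedBall 0 s := by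
  rw [hπ.add_closedBall_eq, hπ.add_closedBall_eq]
  ext x
  constructor
  · rintro ⟨y, hy, rfl⟩
    rw [mem_ofPred_eq] at hy ⊢
    rw [hπ.apply_scaling hs.le, scaling, add_sub_cancel_left, norm_smul, Real.norm_of_nonneg hs.le]
    exact mul_le_of_le_one_right hs.le hy
  · intro hx
    rw [mem_ofPred_eq] at hx
    refine ⟨scaling π s⁻¹ x, ?_, ?_⟩
    · have hs' := inv_nonneg.2 hs.le
      rw [mem_ofPred_eq, hπ.apply_scaling hs', scaling, add_sub_cancel_left, norm_smul,
        Real.norm_of_nonneg hs', inv_mul_le_one₀ hs]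
      exact hx
    · rw [hπ.scaling_scaling (inv_nonneg.2 hs.le), mul_inv_cancel₀ hs.ne', scaling, one_smul,
        add_sub_cancel]

theorem lipschitz_scaling (hπ : IsNearestPointMap K π) (s : ℝ) :
    LipschitzWith (1 + ‖s‖₊ * (1 + 1)) (scaling π s) :=
  hπ.lipschitz.add ((lipschitzWith_smul s).comp (LipschitzWith.id.sub hπ.lipschitz))

/-- Firm nonexpansiveness for `x + t • v` and `x`, divided by t², in the limit t → 0. It forces 0 ≤
⟨Av, v⟩ ≤ ‖v‖². -/
theorem norm_sq_le_inner_of_hasFDerivAt (hπ : IsNearestPointMap K π) {x : E} {A : E →L[ℝ] E}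
    (hA : HasFDerivAt π A x) (v : E) : ‖A v‖ ^ 2 ≤ inner ℝ (A v) v := by
  have h := (hA.hasLineDerivAt v).tendsto_slope_zero
  have h1 := (h.norm.pow 2)
  have h2 := h.inner (𝕜 := ℝ) (tendsto_const_nhds (x := v))
  refine le_of_tendsto_of_tendsto h1 h2 (eventually_nhdsWithin_of_forall fun t ht => ?_)
  have ht : t ≠ 0 := ht
  have h3 := hπ.firmly_nonexpansive (x + t • v) x
  rw [add_sub_cancel_left, real_inner_smul_right] at h3
  have h4 := mul_le_mul_of_nonneg_left h3 (sq_nonneg t⁻¹)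
  simp only [norm_smul, mul_pow, real_inner_smul_left, norm_inv, Real.norm_eq_abs, sq_abs, inv_pow]
  convert h4 using 1
  · simp
  · field_simp

theorem hasFDerivAt_scaling {x : E} {A : E →L[ℝ] E} (hA : HasFDerivAt π A x) (s : ℝ) :
    HasFDerivAt (scaling π s) (A + s • (ContinuousLinearMap.id ℝ E - A)) x :=
  hA.add (((hasFDerivAt_id x).sub hA).const_smul s)

end IsNearestPointMap

end NearestPoint

/-! ### The Jacobian of the scaling map -/

/-- A linear map with positive quadratic form has positive determinant. -/
theorem det_pos_of_inner_pos {E : Type*} [NormedAddCommGroup E] [InnerProductSpace ℝ E]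
    [FiniteDimensional ℝ E] (A : E →ₗ[ℝ] E) (hA : ∀ v ≠ 0, 0 < inner ℝ (A v) v) :
    0 < LinearMap.det A := by
  -- `A` need not be symmetric, so eigenvalues are avoided: every map on the segment from the
  -- identity to `A` has positive quadratic form, hence is invertible, and the determinant cannot
  -- change sign.
  let g : ℝ → ℝ := fun t => LinearMap.det ((1 - t) • (1 : E →ₗ[ℝ] E) + t • A)
  have hg : Continuous g := by
    let b := Module.finBasis ℝ E
    have : g = fun t => Matrix.det ((1 - t) • (1 : Matrix _ _ ℝ) + t • LinearMap.toMatrix b b A) := by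
      funext t
      simp only [g]
      rw [← LinearMap.det_toMatrix b]
      simp [LinearMap.toMatrix_one]
    rw [this]
    exact Continuous.matrix_det (by fun_prop)
  have hne : ∀ t ∈ Icc (0 : ℝ) 1, g t ≠ 0 := by
    intro t ht h0
    obtain ⟨v, hv, hv0⟩ := (Submodule.ne_bot_iff _).1 (LinearMap.bot_lt_ker_of_det_eq_zero h0).ne'
    rw [LinearMap.mem_ker] at hv
    have h1 : inner ℝ (((1 - t) • (1 : E →ₗ[ℝ] E) + t • A) v) v = 0 := by rw [hv, inner_zero_left]
    simp only [LinearMap.add_apply, LinearMap.smul_apply, Module.End.one_apply, inner_add_left,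
      real_inner_smul_left, real_inner_self_eq_norm_sq] at h1
    have h2 := hA v hv0
    have h3 : 0 < ‖v‖ ^ 2 := by positivity
    rcases ht.1.eq_or_lt with rfl | htpos
    · norm_num at h1
      exact hv0 h1
    · nlinarith [mul_pos htpos h2, mul_nonneg (sub_nonneg.2 ht.2) h3.le]
  have h0 : g 0 = 1 := by simp [g]
  have h1 : g 1 = LinearMap.det A := by simp [g]
  rw [← h1]
  by_contra! hle
  obtain ⟨t, ht, htz⟩ := intermediate_value_Icc' zero_le_one hg.continuousOn
    (show (0 : ℝ) ∈ Icc (g 1) (g 0) from ⟨hle, by rw [h0]; exact zero_le_one⟩)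
  exact hne t ht htz

/-- The quadratic form is a + s(‖v‖² - a) with a = ⟨Av, v⟩ in [0, ‖v‖²], so it is positive. The sign
matters because the change of variables produces |det|, which is polynomial in `s` only once the
absolute value can be dropped. -/
theorem IsNearestPointMap.det_scaling_pos {E : Type*} [NormedAddCommGroup E]
    [InnerProductSpace ℝ E] [FiniteDimensional ℝ E] {K : Set E} {π : E → E} (hπ : IsNearestPointMap K π) {x : E} {A : E →L[ℝ] E}
    (hA : HasFDerivAt π A x) {s : ℝ} (hs : 0 < s) :
    0 < (A + s • (ContinuousLinearMap.id ℝ E - A)).det := by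
  refine det_pos_of_inner_pos _ fun v hv => ?_
  have h1 := hπ.norm_sq_le_inner_of_hasFDerivAt hA v
  have h2 := real_inner_le_norm (A v) v
  have hv' : 0 < ‖v‖ := norm_pos_iff.2 hv
  have h3 : ‖A v‖ ≤ ‖v‖ := by
    by_contra! hlt
    nlinarith [norm_nonneg (A v)]
  have h4 : inner ℝ (A v) v ≤ ‖v‖ ^ 2 := h2.trans (by nlinarith)
  have h5 : 0 ≤ inner ℝ (A v) v := (sq_nonneg _).trans h1
  have h6 : inner ℝ ((A + s • (ContinuousLinearMap.id ℝ E - A)) v) v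
      = inner ℝ (A v) v + s * (‖v‖ ^ 2 - inner ℝ (A v) v) := by
    simp [inner_add_left, inner_sub_left, real_inner_smul_left]
  change 0 < inner ℝ ((A + s • (ContinuousLinearMap.id ℝ E - A)) v) v
  rw [h6]
  rcases h5.eq_or_lt with h0 | h0
  · rw [← h0]
    have : 0 < ‖v‖ ^ 2 := by positivity
    nlinarith [mul_pos hs this]
  · nlinarith [mul_nonneg hs.le (sub_nonneg.2 h4)]

/-- The determinant of `A + s (1 - A)` is a polynomial in `s` of degree at most the dimension. -/
theorem exists_polynomial_det {E : Type*} [AddCommGroup E] [Module ℝ E]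
    [FiniteDimensional ℝ E] (A B : E →ₗ[ℝ] E) :
    ∃ P : Polynomial ℝ, P.natDegree ≤ Module.finrank ℝ E ∧
      ∀ s : ℝ, LinearMap.det (A + s • B) = P.eval s := by
  let b := Module.finBasis ℝ E
  refine ⟨_, (Polynomial.natDegree_det_X_add_C_le (LinearMap.toMatrix b b B)
    (LinearMap.toMatrix b b A)).trans (by simp), fun s => ?_⟩
  rw [← LinearMap.det_toMatrix b, ← Polynomial.coe_evalRingHom, RingHom.map_det]
  congr 1
  ext i j
  simp [add_comm, mul_comm s]

/-! ### Steiner's formula -/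

section SteinerPolynomial

variable {E : Type*} [NormedAddCommGroup E] [InnerProductSpace ℝ E] [FiniteDimensional ℝ E]
  [MeasurableSpace E] [BorelSpace E] {K : Set E} {π : E → E}

/-- Haar measure has the same null sets as the Hausdorff measure of full dimension, which a
Lipschitz map enlarges by at most a constant factor. -/
theorem measure_image_eq_zero_of_lipschitz (μ : Measure E) [μ.IsAddHaarMeasure] {f : E → E}
    {C : ℝ≥0} (hf : LipschitzWith C f) {s : Set E} (hs : μ s = 0) : μ (f '' s) = 0 := by
  let ν : Measure E := μH[(Module.finrank ℝ E : ℝ)]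
  have h1 : μ ≪ ν := Measure.absolutelyContinuous_isAddHaarMeasure μ ν
  have h2 : ν ≪ μ := Measure.absolutelyContinuous_isAddHaarMeasure ν μ
  refine h1 (nonpos_iff_eq_zero.1 ((hf.hausdorffMeasure_image_le (Nat.cast_nonneg _) s).trans ?_))
  rw [show μH[(Module.finrank ℝ E : ℝ)] s = 0 from h2 hs, mul_zero]

namespace IsNearestPointMap

theorem exists_polynomial_measure (hπ : IsNearestPointMap K π) (hK : IsCompact K)
    (μ : Measure E) [μ.IsAddHaarMeasure] :
    ∃ Q : Polynomial ℝ, Q.natDegree ≤ Module.finrank ℝ E ∧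
      ∀ s : ℝ, 0 < s → μ.real (K + Metric.closedBall 0 s) = Q.eval s := by
  set n := Module.finrank ℝ E
  have hcomp : ∀ s : ℝ, IsCompact (K + Metric.closedBall 0 s) := fun s =>
    hK.add (isCompact_closedBall _ _)
  let D : Set E := (K + Metric.closedBall 0 1) ∩ {x | DifferentiableAt ℝ π x}
  have hD : MeasurableSet D :=
    (hcomp 1).measurableSet.inter (measurableSet_of_differentiableAt ℝ π)
  let J : ℝ → E → ℝ := fun s x =>
    (fderiv ℝ π x + s • (ContinuousLinearMap.id ℝ E - fderiv ℝ π x)).det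
  have hder : ∀ s, ∀ x ∈ D, HasFDerivWithinAt (scaling π s)
      (fderiv ℝ π x + s • (ContinuousLinearMap.id ℝ E - fderiv ℝ π x)) D x := fun s x hx =>
    (hasFDerivAt_scaling (DifferentiableAt.hasFDerivAt hx.2) s).hasFDerivWithinAt
  have hJpos : ∀ s, 0 < s → ∀ x ∈ D, 0 < J s x := fun s hs x hx =>
    hπ.det_scaling_pos (DifferentiableAt.hasFDerivAt hx.2) hs
  -- By Rademacher's theorem the points lost in passing to `D` are null, and their Lipschitz image
  -- stays null.
  have himg : ∀ s, 0 < s → scaling π s '' D =ᵐ[μ] (K + Metric.closedBall 0 s : Set E) := by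
    intro s hs
    have hsub : scaling π s '' D ⊆ K + Metric.closedBall 0 s := by
      rw [← hπ.image_scaling hs]
      exact image_mono inter_subset_left
    refine hsub.eventuallyLE.antisymm (ae_le_set.2 (measure_mono_null (t := scaling π s ''
      {x | ¬ DifferentiableAt ℝ π x}) ?_ (measure_image_eq_zero_of_lipschitz μ
        (hπ.lipschitz_scaling s) (ae_iff.1 hπ.lipschitz.ae_differentiableAt))))
    rintro y ⟨hy, hyD⟩
    rw [← hπ.image_scaling hs] at hy
    obtain ⟨x, hx, rfl⟩ := hy
    exact ⟨x, fun h => hyD ⟨x, ⟨hx, h⟩, rfl⟩, rfl⟩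
  have hvol : ∀ s, 0 < s → μ.real (K + Metric.closedBall 0 s) = ∫ x in D, J s x ∂μ := by
    intro s hs
    have h := integral_image_eq_integral_abs_det_fderiv_smul μ hD (hder s)
      (hπ.scaling_injective hs).injOn (fun _ => (1 : ℝ))
    rw [setIntegral_congr_set (himg s hs)] at h
    simp only [integral_const, smul_eq_mul, mul_one, measureReal_restrict_apply_univ] at h
    rw [h]
    exact setIntegral_congr_fun hD fun x hx => abs_of_pos (hJpos s hs x hx)
  have hint : ∀ s, 0 < s → IntegrableOn (J s) D μ := by
    intro s hs
    have h := (integrableOn_image_iff_integrableOn_abs_det_fderiv_smul μ hD (hder s)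
      (hπ.scaling_injective hs).injOn (fun _ => (1 : ℝ))).1
      ((integrableOn_congr_set_ae (himg s hs)).2
        (integrableOn_const (hcomp s).measure_lt_top.ne))
    refine h.congr_fun (fun x hx => ?_) hD
    simp only [smul_eq_mul, mul_one]
    exact abs_of_pos (hJpos s hs x hx)
  -- Interpolating at n + 1 nodes expresses `J s x` through the functions `J (v i)`, already known
  -- to be integrable, so the coefficients of the polynomial in `s` need not be integrated. The
  -- shift by 1 keeps the nodes positive, as the change of variables requires.
  let v : ℕ → ℝ := fun i => i + 1
  let S : Finset ℕ := Finset.range (n + 1)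
  have hv : Set.InjOn v S := fun i _ j _ h => by simpa [v] using h
  have hvpos : ∀ i, 0 < v i := fun i => by positivity
  refine ⟨Lagrange.interpolate S v fun i => μ.real (K + Metric.closedBall 0 (v i)), ?_, ?_⟩
  · refine Polynomial.natDegree_le_of_degree_le (Polynomial.degree_le_iff_coeff_zero _ _ |>.2 ?_)
    refine fun m hm => Polynomial.coeff_eq_zero_of_degree_lt (lt_of_lt_of_le ?_
      (show ((n + 1 : ℕ) : WithBot ℕ) ≤ m by exact_mod_cast Nat.succ_le_of_lt (by exact_mod_cast hm)))
    simpa only [S, Finset.card_range] using Lagrange.degree_interpolate_lt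
      (fun i => μ.real (K + Metric.closedBall 0 (v i))) hv
  · intro s hs
    have hJ : ∀ x, J s x = ∑ i ∈ S, J (v i) x * (Lagrange.basis S v i).eval s := by
      intro x
      obtain ⟨P, hP, hPe⟩ := exists_polynomial_det (fderiv ℝ π x : E →ₗ[ℝ] E)
        ((ContinuousLinearMap.id ℝ E - fderiv ℝ π x : E →L[ℝ] E) : E →ₗ[ℝ] E)
      have hPJ : ∀ t, J t x = P.eval t := hPe
      have hdeg : P.degree < S.card := by
        rw [Finset.card_range]
        exact Polynomial.degree_le_natDegree.trans_lt (by exact_mod_cast Nat.lt_succ_of_le hP)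
      rw [hPJ, Lagrange.eq_interpolate hv hdeg, Lagrange.interpolate_apply,
        Polynomial.eval_finsetSum]
      simp [hPJ]
    rw [hvol s hs, Lagrange.interpolate_apply, Polynomial.eval_finsetSum]
    simp_rw [hJ, Polynomial.eval_mul, Polynomial.eval_C]
    rw [integral_finsetSum _ fun i _ => (hint _ (hvpos i)).mul_const _]
    refine Finset.sum_congr rfl fun i _ => ?_
    rw [integral_mul_const, hvol _ (hvpos i)]

end IsNearestPointMap

/-- **Steiner's formula**: the measure of the parallel bodies of a compact convex set is a
polynomial in the radius. -/
theorem exists_steiner_polynomial (hK : IsCompact K) (hc : Convex ℝ K) (hne : K.Nonempty)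
    (μ : Measure E) [μ.IsAddHaarMeasure] :
    ∃ Q : Polynomial ℝ, Q.natDegree ≤ Module.finrank ℝ E ∧
      ∀ s : ℝ, 0 ≤ s → μ.real (K + Metric.closedBall 0 s) = Q.eval s := by
  obtain ⟨π, hπ⟩ := exists_isNearestPointMap hK hc hne
  obtain ⟨Q, hQ, h⟩ := hπ.exists_polynomial_measure hK μ
  refine ⟨Q, hQ, fun s hs => ?_⟩
  rcases hs.eq_or_lt with rfl | hs
  · have h1 : Tendsto (fun s => μ.real (K + Metric.closedBall 0 s)) (𝓝[>] (0 : ℝ)) (𝓝 (μ.real K)) := by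
      have h2 := (ENNReal.tendsto_toReal hK.measure_lt_top.ne).comp
        ((tendsto_measure_cthickening_of_isCompact (μ := μ) hK).mono_left
          (nhdsWithin_le_nhds (s := Ioi 0)))
      refine h2.congr' (eventually_nhdsWithin_of_forall fun s hs => ?_)
      simp only [Function.comp_apply, ← hK.add_closedBall_zero (le_of_lt hs), Measure.real]
    have h3 : Tendsto (fun s => Q.eval s) (𝓝[>] (0 : ℝ)) (𝓝 (Q.eval 0)) :=
      Q.continuous.continuousAt.mono_left nhdsWithin_le_nhds
    have h5 := h3.congr' (by filter_upwards [self_mem_nhdsWithin] with s hs using (h s hs).symm)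
    have h4 := tendsto_nhds_unique h5 h1
    rw [h4]
    simp
  · exact h s hs

end SteinerPolynomial

/-! ### The first variation of the volume of the parallel bodies -/

section FirstVariation

variable {E : Type*} [NormedAddCommGroup E] [InnerProductSpace ℝ E] {K : Set E}

/-- The punctured open star body with radial function `g`. -/
def starBody (g : Metric.sphere (0 : E) 1 → ℝ) : Set E :=
  {x | ∃ (u : Metric.sphere (0 : E) 1) (r : ℝ), 0 < r ∧ r < g u ∧ x = r • (u : E)}

/-- The point r u lies within distance 1 of εk, where `k` attains the support value in direction
`u`. The offset of εk orthogonal to `u` has square at most (εR)², and the correction -ε²R² in the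
radius pays for it. -/
theorem starBody_subset_add_smul {h : Metric.sphere (0 : E) 1 → ℝ} {R ε : ℝ} (hε : 0 < ε)
    (hεR : ε * R ≤ 1 / 2) (hR : ∀ k ∈ K, ‖k‖ ≤ R)
    (hex : ∀ u : Metric.sphere (0 : E) 1, ∃ k ∈ K, inner ℝ (u : E) k = h u) :
    starBody (fun u => 1 + ε * h u - ε ^ 2 * R ^ 2) ⊆ ε • K + Metric.closedBall 0 1 := by
  rintro _ ⟨u, r, hr, hrg, rfl⟩
  obtain ⟨k, hk, hku⟩ := hex u
  have hu : ‖(u : E)‖ = 1 := norm_eq_of_mem_sphere u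
  refine ⟨ε • k, smul_mem_smul_set hk, r • (u : E) - ε • k, ?_, by simp⟩
  rw [mem_closedBall_zero_iff]
  have hkR := hR k hk
  have hR0 : 0 ≤ R := (norm_nonneg k).trans hkR
  have hhR : |h u| ≤ R := by
    rw [← hku]
    exact (abs_real_inner_le_norm _ _).trans (by rw [hu, one_mul]; exact hkR)
  have e : ‖r • (u : E) - ε • k‖ ^ 2 = (r - ε * h u) ^ 2 + ε ^ 2 * (‖k‖ ^ 2 - h u ^ 2) := by
    rw [norm_sub_sq_real, norm_smul, norm_smul, hu, real_inner_smul_left, real_inner_smul_right,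
      hku, mul_pow, mul_pow, Real.norm_eq_abs, Real.norm_eq_abs, sq_abs, sq_abs]
    ring
  -- In terms of `q` the squared distance is at most (1 - q²)² + q² = 1 - q² + q⁴ ≤ 1.
  set q := ε * R with hq
  have hq0 : 0 ≤ q := mul_nonneg hε.le hR0
  have h1 : (r - ε * h u) ^ 2 ≤ (1 - q ^ 2) ^ 2 := by
    refine sq_le_sq' ?_ ?_
    · have : ε * h u ≤ q := mul_le_mul_of_nonneg_left (le_of_abs_le hhR) hε.le
      nlinarith
    · have : ε ^ 2 * R ^ 2 = q ^ 2 := by rw [hq]; ring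
      linarith
  have h2 : ε ^ 2 * (‖k‖ ^ 2 - h u ^ 2) ≤ q ^ 2 := by
    rw [hq, mul_pow]
    refine mul_le_mul_of_nonneg_left ?_ (sq_nonneg _)
    nlinarith [norm_nonneg k, sq_nonneg (h u)]
  have h3 : ‖r • (u : E) - ε • k‖ ^ 2 ≤ 1 ^ 2 := by
    rw [e]
    have hq2 : q ^ 2 ≤ 1 := pow_le_one₀ hq0 (by linarith)
    nlinarith [mul_nonneg (sq_nonneg q) (sub_nonneg.2 hq2)]
  exact le_of_sq_le_sq h3 zero_le_one

/-- Pairing `x` with its own direction gives ‖x‖ ≤ 1 + ε h(u). The extra ε² only makes the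
inequality strict, as the open star body demands. -/
theorem add_smul_diff_subset_starBody {h : Metric.sphere (0 : E) 1 → ℝ} {ε : ℝ} (hε : 0 < ε)
    (hle : ∀ u : Metric.sphere (0 : E) 1, ∀ k ∈ K, inner ℝ (u : E) k ≤ h u) :
    (ε • K + Metric.closedBall 0 1) \ {0} ⊆ starBody (fun u => 1 + ε * h u + ε ^ 2) := by
  rintro x ⟨hx, hx0⟩
  have hx0 : x ≠ 0 := hx0
  have hxn : 0 < ‖x‖ := norm_pos_iff.2 hx0
  let u : Metric.sphere (0 : E) 1 := ⟨‖x‖⁻¹ • x, by simp [norm_smul, hxn.ne']⟩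
  have hxu : x = ‖x‖ • (u : E) := by simp [u, smul_smul, hxn.ne']
  refine ⟨u, ‖x‖, hxn, ?_, hxu⟩
  have hu : ‖(u : E)‖ = 1 := norm_eq_of_mem_sphere u
  have e : inner ℝ (u : E) x = ‖x‖ := by
    nth_rewrite 1 [hxu]
    rw [real_inner_smul_right, real_inner_self_eq_norm_sq, hu]
    ring
  obtain ⟨_, ⟨k, hk, rfl⟩, b, hb, hkb⟩ := hx
  rw [mem_closedBall_zero_iff] at hb
  rw [← e, ← hkb]
  simp only [inner_add_right, real_inner_smul_right]
  have h1 : inner ℝ (u : E) b ≤ 1 := (real_inner_le_norm _ _).trans (by rw [hu, one_mul]; exact hb)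
  have h2 := mul_le_mul_of_nonneg_left (hle u k hk) hε.le
  have h3 : 0 < ε ^ 2 := by positivity
  linarith

variable [FiniteDimensional ℝ E] [MeasurableSpace E] [BorelSpace E] [Nontrivial E]

/-- Polar coordinates: the radial integral of r^(n-1) up to g(u) is g(u)^n / n. -/
theorem measure_starBody (μ : Measure E) [μ.IsAddHaarMeasure] {g : Metric.sphere (0 : E) 1 → ℝ}
    (hg : Continuous g) (hpos : ∀ u, 0 < g u) :
    μ (starBody g) =
      ENNReal.ofReal ((∫ u, g u ^ Module.finrank ℝ E ∂μ.toSphere) / Module.finrank ℝ E) := by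
  set n := Module.finrank ℝ E with hn
  have hn0 : 0 < n := Module.finrank_pos
  let T : Set (Metric.sphere (0 : E) 1 × Ioi (0 : ℝ)) := {p | (p.2 : ℝ) < g p.1}
  have hT : MeasurableSet T := (isOpen_lt (by fun_prop) (by fun_prop)).measurableSet
  have hS : starBody g = Subtype.val '' (homeomorphUnitSphereProd E ⁻¹' T) := by
    rw [← Homeomorph.image_symm, image_image]
    ext x
    constructor
    · rintro ⟨u, r, hr, hrg, rfl⟩
      exact ⟨(u, ⟨r, hr⟩), hrg, by simp⟩
    · rintro ⟨⟨u, r⟩, hr, rfl⟩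
      exact ⟨u, r, r.2, hr, by simp⟩
  have h0 : MeasurableSet ({0}ᶜ : Set E) := (measurableSet_singleton _).compl
  rw [hS, ← (MeasurableEmbedding.subtype_coe h0).comap_apply,
    μ.measurePreserving_homeomorphUnitSphereProd.measure_preimage hT.nullMeasurableSet,
    Measure.prod_apply hT]
  have h1 : ∀ u, Measure.volumeIoiPow (n - 1) (Prod.mk u ⁻¹' T) = ENNReal.ofReal (g u ^ n / n) := by
    intro u
    have : Prod.mk u ⁻¹' T = Iio ⟨g u, hpos u⟩ := by
      ext r
      simp [T, ← Subtype.coe_lt_coe]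
    rw [this, Measure.volumeIoiPow_apply_Iio, Nat.sub_add_cancel hn0]
    congr 2
    rw [Nat.cast_sub hn0]
    simp
  simp_rw [← hn, h1]
  rw [← ofReal_integral_eq_lintegral_ofReal, integral_div]
  · exact (((hg.pow n).div_const _).integrable_of_hasCompactSupport
      (HasCompactSupport.of_compactSpace _))
  · exact Eventually.of_forall fun u => div_nonneg (pow_nonneg (hpos u).le _) (Nat.cast_nonneg _)

/-- First order expansion of the volume of the parallel bodies of the unit ball. -/
theorem exists_abs_measure_add_smul_sub_le (μ : Measure E) [μ.IsAddHaarMeasure] (hK : IsCompact K)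
    {h : Metric.sphere (0 : E) 1 → ℝ} (hh : Continuous h)
    (hle : ∀ u : Metric.sphere (0 : E) 1, ∀ k ∈ K, inner ℝ (u : E) k ≤ h u)
    (hex : ∀ u : Metric.sphere (0 : E) 1, ∃ k ∈ K, inner ℝ (u : E) k = h u) :
    ∃ (a C ε₀ : ℝ), 0 < ε₀ ∧ ∀ ε, 0 < ε → ε < ε₀ →
      |μ.real (ε • K + Metric.closedBall 0 1) - a - ε * ∫ u, h u ∂μ.toSphere| ≤ C * ε ^ 2 := by
  set n := Module.finrank ℝ E with hn
  have hn0 : 0 < n := Module.finrank_pos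
  have hn1 : (1 : ℝ) ≤ n := by exact_mod_cast hn0
  obtain ⟨R, hRpos, hR⟩ := hK.isBounded.exists_pos_norm_le
  have hhR : ∀ u, |h u| ≤ R := by
    intro u
    obtain ⟨k, hk, hku⟩ := hex u
    rw [← hku]
    refine (abs_real_inner_le_norm _ _).trans ?_
    rw [norm_eq_of_mem_sphere u, one_mul]
    exact hR k hk
  have hint : ∀ g : Metric.sphere (0 : E) 1 → ℝ, Continuous g → Integrable g μ.toSphere :=
    fun g hg => hg.integrable_of_hasCompactSupport (HasCompactSupport.of_compactSpace _)
  set σ := μ.toSphere.real univ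
  have hσ : 0 ≤ σ := measureReal_nonneg
  have hb : 0 < (2 * n * (R + 1))⁻¹ := by positivity
  -- The constant adds the errors of the two bounds below, R²σ from `lower` and (1 + n(R+1)²)σ from
  -- `upper`. The threshold makes nε(R+1) ≤ 1/2, which keeps both radial functions positive and the
  -- exponent in `upper` small.
  refine ⟨σ / n, (R ^ 2 + 1 + n * (R + 1) ^ 2) * σ, (2 * n * (R + 1))⁻¹, hb, fun ε hε hε0 => ?_⟩
  have hεn : n * (ε * (R + 1)) ≤ 1 / 2 := by
    rw [lt_inv_comm₀ hε (by positivity)] at hε0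
    have := mul_lt_mul_of_pos_left hε0 hε
    rw [mul_inv_cancel₀ hε.ne'] at this
    linarith
  have hεR1 : ε * (R + 1) ≤ 1 / 2 := by
    have : 0 ≤ ε * (R + 1) := by positivity
    nlinarith
  have hεR : ε * R ≤ 1 / 2 := by nlinarith
  have hε1 : ε ≤ 1 := by nlinarith [mul_pos hε hRpos]
  have hεh : ∀ u, |ε * h u| ≤ ε * R := fun u => by
    rw [abs_mul, abs_of_pos hε]
    exact mul_le_mul_of_nonneg_left (hhR u) hε.le
  have hmeas : (μ (ε • K + Metric.closedBall 0 1)) ≠ ∞ :=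
    ((hK.smul ε).add (isCompact_closedBall _ _)).measure_lt_top.ne
  set V := μ.real (ε • K + Metric.closedBall 0 1) with hV
  set b := ∫ u, h u ∂μ.toSphere with hbdef
  have haff : ∀ c : ℝ, ∫ u, (1 + n * (ε * h u) + c) ∂μ.toSphere = σ + n * ε * b + c * σ := by
    intro c
    rw [integral_add (hint _ (by fun_prop)) (hint _ (by fun_prop)),
      integral_add (hint _ (by fun_prop)) (hint _ (by fun_prop)), integral_const_mul,
      integral_const_mul, integral_const, integral_const, ← hbdef]
    simp only [smul_eq_mul]
    ring
  have lower : σ + n * ε * b + (-(n * (ε ^ 2 * R ^ 2))) * σ ≤ n * V := by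
    have hpos : ∀ u, 0 < 1 + ε * h u - ε ^ 2 * R ^ 2 := fun u => by
      have := neg_le_of_abs_le (hεh u)
      nlinarith [mul_pos hε hRpos]
    have h1 := ENNReal.toReal_mono hmeas
      (measure_mono (μ := μ) (starBody_subset_add_smul hε hεR hR hex))
    rw [measure_starBody μ (by fun_prop) hpos, ENNReal.toReal_ofReal
      (div_nonneg (integral_nonneg fun u => pow_nonneg (hpos u).le _) (Nat.cast_nonneg _)),
      ← hn, div_le_iff₀' (by positivity)] at h1
    refine le_trans ?_ h1
    rw [← haff]
    refine integral_mono (hint _ (by fun_prop)) (hint _ (by fun_prop)) fun u => ?_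
    -- Bernoulli's inequality bounds the n-th power from below by its linear part.
    have h2 := one_add_mul_le_pow (a := ε * h u - ε ^ 2 * R ^ 2) (by linarith [hpos u]) n
    dsimp only
    calc _ = 1 + n * (ε * h u - ε ^ 2 * R ^ 2) := by ring
      _ ≤ _ := h2
      _ = _ := by ring
  have upper : n * V ≤ σ + n * ε * b + (n * ε ^ 2 + n ^ 2 * (ε * (R + 1)) ^ 2) * σ := by
    have hpos : ∀ u, 0 < 1 + ε * h u + ε ^ 2 := fun u => by
      have := neg_le_of_abs_le (hεh u)
      nlinarith [mul_pos hε hRpos]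
    have h1 := measure_mono (μ := μ) (add_smul_diff_subset_starBody hε hle)
    rw [measure_sdiff_null (measure_singleton _), measure_starBody μ (by fun_prop) hpos] at h1
    have h1 := ENNReal.toReal_mono ENNReal.ofReal_ne_top h1
    rw [ENNReal.toReal_ofReal
      (div_nonneg (integral_nonneg fun u => pow_nonneg (hpos u).le _) (Nat.cast_nonneg _)),
      ← hn, le_div_iff₀' (by positivity)] at h1
    refine h1.trans ?_
    rw [← haff]
    refine integral_mono (hint _ (by fun_prop)) (hint _ (by fun_prop)) fun u => ?_
    set t := ε * h u + ε ^ 2 with ht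
    have ht1 : |t| ≤ ε * (R + 1) := by
      refine (abs_add_le _ _).trans ?_
      rw [abs_of_nonneg (sq_nonneg ε)]
      nlinarith [hεh u]
    have hnt : |n * t| ≤ n * (ε * (R + 1)) := by
      rw [abs_mul, Nat.abs_cast]
      exact mul_le_mul_of_nonneg_left ht1 (Nat.cast_nonneg _)
    -- From above, (1 + t)^n ≤ exp(nt) ≤ 1 + nt + (nt)², the last step being valid for |nt| ≤ 1.
    have h2 := Real.abs_exp_sub_one_sub_id_le (x := n * t) (by linarith)
    have h3 : (n * t) ^ 2 ≤ (n * (ε * (R + 1))) ^ 2 := by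
      rw [← sq_abs]
      exact pow_le_pow_left₀ (abs_nonneg _) hnt 2
    have h4 : (1 + ε * h u + ε ^ 2) ^ n ≤ Real.exp (n * t) := by
      rw [Real.exp_nat_mul]
      refine pow_le_pow_left₀ (hpos u).le ?_ n
      have := Real.add_one_le_exp t
      linarith
    have h5 := le_of_abs_le h2
    dsimp only
    nlinarith
  rw [abs_le]
  constructor
  · refine le_of_mul_le_mul_left ?_ (show (0 : ℝ) < n by positivity)
    have e : (n : ℝ) * (V - σ / n - ε * b) = n * V - σ - n * ε * b := by field_simp
    rw [e]
    have : 0 ≤ n * ((1 + n * (R + 1) ^ 2) * σ * ε ^ 2) := by positivity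
    linarith
  · refine le_of_mul_le_mul_left ?_ (show (0 : ℝ) < n by positivity)
    have e : (n : ℝ) * (V - σ / n - ε * b) = n * V - σ - n * ε * b := by field_simp
    rw [e]
    have : 0 ≤ n * (R ^ 2 * σ * ε ^ 2) := by positivity
    linarith

end FirstVariation

/-! ### Low-order coefficients of a polynomial from its behaviour near zero -/

section PolynomialCoeff

open Polynomial

theorem coeff_zero_eq_zero_of_abs_eval_le {P : ℝ[X]} {C ε₀ : ℝ} (hε₀ : 0 < ε₀)
    (h : ∀ ε, 0 < ε → ε < ε₀ → |P.eval ε| ≤ C * ε) : P.coeff 0 = 0 := by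
  have h1 : Tendsto (fun ε => |P.eval ε|) (𝓝[>] (0 : ℝ)) (𝓝 |P.eval 0|) :=
    P.continuous.abs.continuousAt.mono_left nhdsWithin_le_nhds
  have h2 : Tendsto (fun ε => C * ε) (𝓝[>] (0 : ℝ)) (𝓝 (C * 0)) :=
    (continuous_const.mul continuous_id).continuousAt.mono_left nhdsWithin_le_nhds
  have h3 := le_of_tendsto_of_tendsto h1 h2
    (by filter_upwards [Ioo_mem_nhdsGT hε₀] with ε hε using h ε hε.1 hε.2)
  rw [mul_zero] at h3
  rw [coeff_zero_eq_eval_zero]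
  exact abs_nonpos_iff.1 h3

/-- After subtracting a + bX, the constant-coefficient lemma applies twice: to the difference, and
then to its quotient by X. -/
theorem coeff_one_eq_of_abs_eval_sub_le {P : ℝ[X]} {a b C ε₀ : ℝ} (hε₀ : 0 < ε₀)
    (h : ∀ ε, 0 < ε → ε < ε₀ → |P.eval ε - a - ε * b| ≤ C * ε ^ 2) : P.coeff 1 = b := by
  set D := P - Polynomial.C a - X * Polynomial.C b with hD
  have hDe : ∀ ε, D.eval ε = P.eval ε - a - ε * b := fun ε => by simp [hD, mul_comm b]
  have h0 : D.coeff 0 = 0 := by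
    refine coeff_zero_eq_zero_of_abs_eval_le (C := |C| * ε₀) hε₀ fun ε hε hε' => ?_
    rw [hDe]
    refine (h ε hε hε').trans ?_
    rw [sq, ← mul_assoc]
    refine mul_le_mul_of_nonneg_right ?_ hε.le
    calc C * ε ≤ |C| * ε := mul_le_mul_of_nonneg_right (le_abs_self C) hε.le
      _ ≤ |C| * ε₀ := mul_le_mul_of_nonneg_left hε'.le (abs_nonneg C)
  have h1 : D.divX.coeff 0 = 0 := by
    refine coeff_zero_eq_zero_of_abs_eval_le (C := C) hε₀ fun ε hε hε' => ?_
    have e := congrArg (eval ε) (divX_mul_X_add D)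
    rw [h0, eval_add, eval_mul, eval_X, eval_C, add_zero, hDe] at e
    have h2 := h ε hε hε'
    rw [← e, abs_mul, abs_of_pos hε, sq, ← mul_assoc] at h2
    exact le_of_mul_le_mul_right h2 hε
  rw [coeff_divX] at h1
  simp [hD, coeff_C] at h1
  linarith

end PolynomialCoeff

/-! ### Evaluation on real numbers and the decomposition -/

section Evaluation

variable {N : ℕ}

theorem decompCoeff_spec (f : CN N) : IsDecomposition f (decompCoeff f) :=
  (existsUnique_decomposition f).choose_spec.1

open Classical in
/-- The point mass at an atom. -/
theorem isAdditive_pointMass (J : Finset (Fin N)) : IsAdditive (N := N)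
    (fun g => if J ∈ (g : BoolAlg N) then (1 : ℝ) else 0) := by
  intro a b hab
  have : ¬ (J ∈ (a : BoolAlg N) ∧ J ∈ (b : BoolAlg N)) := fun hJ => by
    have : J ∈ (a : BoolAlg N) ∩ b := hJ
    simp [hab] at this
  by_cases ha : J ∈ (a : BoolAlg N) <;> by_cases hb : J ∈ (b : BoolAlg N) <;> simp_all

theorem le_evalReal_iff (f : LatN N) (y : Fin N → ℝ) (c : ℝ) :
    c ≤ evalReal f y ↔ Finset.univ.filter (fun i => y i < c) ∈ (f : BoolAlg N) := by
  rw [evalReal, LatExpr.le_eval_iff, (exists_expr f).choose_spec]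

/-- The atom of an index set J lies in u_I iff I is not contained in J. Together with
`le_evalReal_iff`, one atom thus tests the level `c` for `f` and for all the maxima. -/
theorem filter_lt_mem_unionGen_iff (I : NonemptySubset N) (y : Fin N → ℝ) (c : ℝ) :
    Finset.univ.filter (fun i => y i < c) ∈ (unionGen I : BoolAlg N) ↔ c ≤ I.1.sup' I.2 y := by
  simp [unionGen, gen]

theorem LatExpr.exists_eval_eq (y : Fin N → ℝ) (e : LatExpr N) : ∃ i, e.eval y = y i := by
  induction e with
  | var j => exact ⟨j, rfl⟩
  | union s t hs ht =>
    rcases max_choice (s.eval y) (t.eval y) with h | h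
    · simpa only [LatExpr.eval, h] using hs
    · simpa only [LatExpr.eval, h] using ht
  | inter s t hs ht =>
    rcases min_choice (s.eval y) (t.eval y) with h | h
    · simpa only [LatExpr.eval, h] using hs
    · simpa only [LatExpr.eval, h] using ht

open Classical in
/-- The value of a lattice element on real numbers is the combination, with the coefficients of the
decomposition, of the maxima over the sets of indices. -/
theorem evalReal_eq_sum (f : LatN N) (y : Fin N → ℝ) :
    evalReal f y = ∑ I : NonemptySubset N,
      (decompCoeff ⟨f, LatN_subset_CN f.2⟩ I : ℝ) * I.1.sup' I.2 y := by
  set m := decompCoeff ⟨(f : BoolAlg N), LatN_subset_CN f.2⟩ with hm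
  have hlevel : ∀ c : ℝ, (if c ≤ evalReal f y then (1 : ℝ) else 0)
      = ∑ I, (m I : ℝ) * if c ≤ I.1.sup' I.2 y then 1 else 0 := by
    intro c
    have h := decompCoeff_spec ⟨f, LatN_subset_CN f.2⟩ _
      (isAdditive_pointMass (Finset.univ.filter (fun i => y i < c)))
    simpa only [filter_lt_mem_unionGen_iff, ← le_evalReal_iff] using h
  obtain ⟨M, hM⟩ : ∃ M : ℝ, ∀ i, |y i| ≤ M := by
    obtain ⟨M, hM⟩ := (Set.finite_range fun i => |y i|).bddAbove
    exact ⟨M, fun i => hM ⟨i, rfl⟩⟩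
  obtain ⟨i₀, hi₀⟩ : ∃ i, evalReal f y = y i := LatExpr.exists_eval_eq y _
  have hsup : ∀ I : NonemptySubset N, -M ≤ I.1.sup' I.2 y ∧ I.1.sup' I.2 y ≤ M := by
    intro I
    obtain ⟨i, -, hi⟩ := Finset.exists_mem_eq_sup' I.2 y
    rw [hi]
    exact abs_le.1 (hM i)
  -- Integrating the identity of indicators over (-M, M] turns each level `a` into a + M.
  have hint : ∀ a, -M ≤ a → a ≤ M →
      IntegrableOn (fun c : ℝ => if c ≤ a then (1 : ℝ) else 0) (Ioc (-M) M) ∧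
      ∫ c in Ioc (-M) M, (if c ≤ a then (1 : ℝ) else 0) = a + M := by
    intro a h1 h2
    have e : (fun c : ℝ => if c ≤ a then (1 : ℝ) else 0) = (Iic a).indicator fun _ => 1 := by
      ext c
      simp [indicator_apply]
    rw [e]
    refine ⟨(integrable_const _).indicator measurableSet_Iic, ?_⟩
    rw [setIntegral_indicator measurableSet_Iic, Ioc_inter_Iic, min_eq_right h2]
    simp [neg_le_iff_add_nonneg.1 h1]
  -- At c = -M all the indicators are 1, so the coefficients sum to 1; this cancels the shifts by M.
  have htotal : (1 : ℝ) = ∑ I, (m I : ℝ) := by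
    have h := hlevel (-M)
    rw [if_pos (by rw [hi₀]; exact (abs_le.1 (hM i₀)).1)] at h
    rw [h]
    exact Finset.sum_congr rfl fun I _ => by rw [if_pos (hsup I).1, mul_one]
  have h := (hint (evalReal f y) (by rw [hi₀]; exact (abs_le.1 (hM i₀)).1)
    (by rw [hi₀]; exact (abs_le.1 (hM i₀)).2)).2
  simp_rw [hlevel] at h
  rw [integral_finsetSum _ fun I _ => (hint _ (hsup I).1 (hsup I).2).1.const_mul _] at h
  simp_rw [integral_const_mul, fun I => (hint _ (hsup I).1 (hsup I).2).2, mul_add,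
    Finset.sum_add_distrib, ← Finset.sum_mul, ← htotal, one_mul] at h
  linarith

end Evaluation

/-! ### The first intrinsic volume -/

section IntrinsicVolume

variable {d : ℕ} {K : Set (EuclideanSpace ℝ (Fin d))}

theorem kappa_pos (n : ℕ) : 0 < kappa n :=
  ENNReal.toReal_pos (Metric.measure_closedBall_pos _ _ one_pos).ne'
    (isCompact_closedBall _ _).measure_lt_top.ne

theorem exists_isSteinerCoeff (hK : IsCompact K) (hc : Convex ℝ K) (hne : K.Nonempty) :
    ∃ V, IsSteinerCoeff K V := by
  obtain ⟨Q, hQ, h⟩ := exists_steiner_polynomial hK hc hne volume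
  rw [finrank_euclideanSpace_fin] at hQ
  refine ⟨fun k => if k ≤ d then Q.coeff (d - k) / kappa (d - k) else 0, fun r hr => ?_,
    fun k hk => if_neg (not_le.2 hk)⟩
  rw [h r hr, Polynomial.eval_eq_sum_range' (Nat.lt_succ_of_le hQ), ← Finset.sum_range_reflect]
  refine Finset.sum_congr rfl fun k hk => ?_
  have hk : k ≤ d := Nat.lt_succ_iff.1 (Finset.mem_range.1 hk)
  dsimp only
  rw [if_pos hk, mul_div_cancel₀ _ (kappa_pos _).ne', Nat.succ_sub_one]

/-- Steiner's formula rules out the default value 0 in the definition, and one choice of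
coefficients serves all `k` at once. -/
theorem isSteinerCoeff_intrinsicVolume (hK : IsCompact K) (hc : Convex ℝ K) (hne : K.Nonempty) :
    IsSteinerCoeff K fun k => intrinsicVolume k K := by
  have h := exists_isSteinerCoeff hK hc hne
  simp only [intrinsicVolume, dif_pos h]
  exact h.choose_spec

/-- The first intrinsic volume is a multiple of the mean of the support function. -/
theorem kappa_mul_intrinsicVolume_one (hd : 1 ≤ d) (hK : IsCompact K) (hc : Convex ℝ K)
    (hne : K.Nonempty) {h : Metric.sphere (0 : EuclideanSpace ℝ (Fin d)) 1 → ℝ} (hh : Continuous h)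
    (hle : ∀ u : Metric.sphere (0 : EuclideanSpace ℝ (Fin d)) 1, ∀ k ∈ K,
      inner ℝ (u : EuclideanSpace ℝ (Fin d)) k ≤ h u)
    (hex : ∀ u : Metric.sphere (0 : EuclideanSpace ℝ (Fin d)) 1, ∃ k ∈ K,
      inner ℝ (u : EuclideanSpace ℝ (Fin d)) k = h u) :
    kappa (d - 1) * intrinsicVolume 1 K =
      ∫ u, h u ∂(volume : Measure (EuclideanSpace ℝ (Fin d))).toSphere := by
  have : NeZero d := ⟨by omega⟩
  have hV := (isSteinerCoeff_intrinsicVolume hK hc hne).1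
  -- Since εK + B = ε(K + ε⁻¹B), the volume of εK + B is ε^d times the Steiner polynomial at ε⁻¹.
  -- This reverses the order of the coefficients and puts V_1 at the linear term.
  let P : Polynomial ℝ := ∑ k ∈ Finset.range (d + 1),
    Polynomial.monomial k (kappa (d - k) * intrinsicVolume k K)
  have hP : P.coeff 1 = kappa (d - 1) * intrinsicVolume 1 K := by
    simp only [P, Polynomial.finsetSum_coeff, Polynomial.coeff_monomial]
    rw [Finset.sum_ite_eq', if_pos (Finset.mem_range.2 (by omega))]
  have hPe : ∀ ε : ℝ, 0 < ε →
      volume.real (ε • K + Metric.closedBall 0 1) = P.eval ε := by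
    intro ε hε
    have e : ε • K + Metric.closedBall 0 1 = ε • (K + Metric.closedBall 0 ε⁻¹) := by
      rw [smul_add, _root_.smul_closedBall _ _ (inv_nonneg.2 hε.le), smul_zero,
        Real.norm_of_nonneg hε.le, mul_inv_cancel₀ hε.ne']
    rw [e, Measure.real, Measure.addHaar_smul_of_nonneg _ hε.le, ENNReal.toReal_mul,
      ENNReal.toReal_ofReal (by positivity), ← Measure.real, hV _ (inv_nonneg.2 hε.le),
      finrank_euclideanSpace_fin, Polynomial.eval_finsetSum, Finset.mul_sum]
    refine Finset.sum_congr rfl fun k hk => ?_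
    have hk : k ≤ d := Nat.lt_succ_iff.1 (Finset.mem_range.1 hk)
    rw [Polynomial.eval_monomial, inv_pow]
    have : ε ^ d = ε ^ k * ε ^ (d - k) := by rw [← pow_add, Nat.add_sub_cancel' hk]
    rw [this]
    field_simp
  obtain ⟨a, C, ε₀, hε₀, hC⟩ := exists_abs_measure_add_smul_sub_le volume hK hh hle hex
  rw [← hP]
  exact coeff_one_eq_of_abs_eval_sub_le hε₀ fun ε hε hε' => hPe ε hε ▸ hC ε hε hε'

end IntrinsicVolume

/-! ### Support functions of convex hulls of finitely many points -/

section Hull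

variable {d N : ℕ}

theorem continuous_sup'_inner (p : Fin N → EuclideanSpace ℝ (Fin d)) (I : NonemptySubset N) :
    Continuous fun u : Metric.sphere (0 : EuclideanSpace ℝ (Fin d)) 1 =>
      I.1.sup' I.2 fun i => inner ℝ (u : EuclideanSpace ℝ (Fin d)) (p i) :=
  Continuous.finset_sup'_apply I.2 fun _ _ => by fun_prop

/-- A half-space containing the points contains their hull, so the support function is the maximum
over the points and is attained at one of them. -/
theorem kappa_mul_intrinsicVolume_one_hullOf (hd : 1 ≤ d) (p : Fin N → EuclideanSpace ℝ (Fin d))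
    (I : NonemptySubset N) :
    kappa (d - 1) * intrinsicVolume 1 (hullOf p I.1) =
      ∫ u : Metric.sphere (0 : EuclideanSpace ℝ (Fin d)) 1,
        I.1.sup' I.2 (fun i => inner ℝ (u : EuclideanSpace ℝ (Fin d)) (p i))
        ∂(volume : Measure (EuclideanSpace ℝ (Fin d))).toSphere := by
  refine kappa_mul_intrinsicVolume_one hd
    (((I.1.finite_toSet).image p).isCompact_convexHull (𝕜 := ℝ)) (convex_convexHull ℝ _)
    ((I.2.to_set.image p).convexHull) (continuous_sup'_inner p I) (fun u => ?_) fun u => ?_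
  · have hconv : Convex ℝ {k : EuclideanSpace ℝ (Fin d) |
        inner ℝ (u : EuclideanSpace ℝ (Fin d)) k ≤
          I.1.sup' I.2 fun i => inner ℝ (u : EuclideanSpace ℝ (Fin d)) (p i)} :=
      convex_halfSpace_le (innerₛₗ ℝ (u : EuclideanSpace ℝ (Fin d))).isLinear _
    refine fun k hk => convexHull_min ?_ hconv hk
    rintro _ ⟨i, hi, rfl⟩
    exact Finset.le_sup' (fun i => inner ℝ (u : EuclideanSpace ℝ (Fin d)) (p i)) hi
  · obtain ⟨i, hi, he⟩ := Finset.exists_mem_eq_sup' I.2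
      fun i => inner ℝ (u : EuclideanSpace ℝ (Fin d)) (p i)
    exact ⟨p i, subset_convexHull ℝ _ ⟨i, hi, rfl⟩, he.symm⟩

end Hull

end BooleanVolume

end

open MeasureTheory BooleanVolume in
/-- For `f` in the lattice generated by `x_1, …, x_N` with `∪` and `∩`, and `N` points of `ℝᵈ`,
`V_{f,1}(p) = κ_{d-1}⁻¹ ∫ f(⟨u, p_1⟩, …, ⟨u, p_N⟩) du` over the unit sphere with its surface
measure; the integrand is integrable. -/
theorem theorem5p4 (d N : ℕ) (hd : 1 ≤ d) (hN : 1 ≤ N) (f : BoolAlg N) (hf : f ∈ LatN N)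
    (p : Fin N → EuclideanSpace ℝ (Fin d)) :
    Integrable (fun u : Metric.sphere (0 : EuclideanSpace ℝ (Fin d)) 1 =>
        evalReal ⟨f, hf⟩ (fun i => inner ℝ (u : EuclideanSpace ℝ (Fin d)) (p i)))
      (volume : Measure (EuclideanSpace ℝ (Fin d))).toSphere ∧
    boolIntrinsicVolume ⟨f, LatN_subset_CN hf⟩ 1 p =
      (1 / kappa (d - 1)) *
        ∫ u : Metric.sphere (0 : EuclideanSpace ℝ (Fin d)) 1,
          evalReal ⟨f, hf⟩ (fun i => inner ℝ (u : EuclideanSpace ℝ (Fin d)) (p i))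
          ∂(volume : Measure (EuclideanSpace ℝ (Fin d))).toSphere := by
  have hint : ∀ I : NonemptySubset N, Integrable
      (fun u : Metric.sphere (0 : EuclideanSpace ℝ (Fin d)) 1 =>
        (decompCoeff ⟨f, LatN_subset_CN hf⟩ I : ℝ) *
          I.1.sup' I.2 fun i => inner ℝ (u : EuclideanSpace ℝ (Fin d)) (p i))
      (volume : Measure (EuclideanSpace ℝ (Fin d))).toSphere := fun I =>
    ((continuous_sup'_inner p I).integrable_of_hasCompactSupport
      (HasCompactSupport.of_compactSpace _)).const_mul _
  -- The integrand becomes a finite combination of continuous functions on the compact sphere, and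
  -- the identity can be checked for each I separately.
  simp_rw [evalReal_eq_sum]
  refine ⟨integrable_finsetSum _ fun I _ => hint I, ?_⟩
  rw [integral_finsetSum _ fun I _ => hint I, boolIntrinsicVolume, Finset.mul_sum]
  refine Finset.sum_congr rfl fun I _ => ?_
  rw [integral_const_mul, ← kappa_mul_intrinsicVolume_one_hullOf hd]
  have := (kappa_pos (d - 1)).ne'
  field_simp
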